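/- Throughout, $\mathbb{R}^n$ and products such as $\mathbb{R}^n\times\mathbb{R}^N\times\mathbb{R}$ carry the Euclidean inner product and norm, and $\mathcal{S}^d$ is the space of real symmetric $d\times d$ matrices; $X\succeq 0$ (resp. $X\succ0$) means that $X$ is positive semidefinite (resp. positive definite). **Definitions.** Let $h$ be a function from a finite-dimensional Euclidean space to $\mathbb{R}\cup\{\infty\}$. It is *proper* if $\operatorname{dom}h=\{x: h(x)<\infty\}\neq\emptyset$, and a proper function is *closed* if it is lower semicontinuous. For $x\in\operatorname{dom}h$ the regular subdifferential is $$\hat\partial h(x)=\Big\{\zeta:\ \liminf_{z\to x,\,z\ne x}\frac{h(z)-h(x)-\langle\zeta,z-x\rangle}{\|z-x\|}\ge 0\Big\},$$ and the subdifferential $\partial h(x)$ is the set of all $\zeta$ for which there are $x^k\to x$ with $h(x^k)\to h(x)$ and $\zeta^k\to\zeta$ with $\zeta^k\in\hat\partial h(x^k)$ for all $k$; both sets are empty for $x\notin\operatorname{dom}h$. Put $\operatorname{dom}\partial h=\{x:\partial h(x)\ne\emptyset\}$. A proper closed $h$ *satisfies the KL property at $\hat x\in\operatorname{dom}\partial h$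 with exponent $\alpha\in[0,1)$* if there are $\bar c>0$, $a\in(0,\infty]$ and a neighborhood $V$ of $\hat x$ such that, with $\varphi(s)=\bar c\,s^{1-\alpha}$, $$\varphi'\big(h(x)-h(\hat x)\big)\,\operatorname{dist}\big(0,\partial h(x)\big)\ge 1\qquad\text{for all }x\in V\text{ with }h(\hat x)<h(x)<h(\hat x)+a,$$ where $\operatorname{dist}(0,\emptyset)=\infty$. **Theorem (KL exponent of SDP-representable functions).** Let $f:\mathbb{R}^n\to\mathbb{R}\cup\{\infty\}$ be proper and closed, and let $\bar x\in\operatorname{dom}\partial f$. Suppose that $f$ is SDP-representable: for some $d\ge1$, $N\ge1$ and $A_{00},A_0,A_1,\dots,A_n,B_1,\dots,B_N\in\mathcal{S}^d$, $$\operatorname{epi}f:=\{(x,t)\in\mathbb{R}^n\times\mathbb{R}:f(x)\le t\}=\{(x,t)\in\mathbb{R}^n\times\mathbb{R}:\ \exists u\in\mathbb{R}^N,\ (x,u,t)\in\mathfrak{D}\},$$ where $\mathfrak{D}=\{(x,u,t)\in\mathbb{R}^n\times\mathbb{R}^N\times\mathbb{R}: A_{00}+\mathcal{A}^*(x,u,t)\succeq0\}$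 and $\mathcal{A}^*(x,u,t)=tA_0+\sum_{i=1}^n x_iA_i+\sum_{j=1}^N u_jB_j$. Let $F(x,u,t)=t+\delta_{\mathfrak{D}}(x,u,t)$, where $\delta_{\mathfrak{D}}$ is $0$ on $\mathfrak{D}$ and $\infty$ elsewhere, and let $\mathfrak{D}_{\bar x}=\{u\in\mathbb{R}^N:(\bar x,u,f(\bar x))\in\mathfrak{D}\}$. Suppose that 1. (Slater's condition) there is $(x^s,u^s,t^s)\in\mathbb{R}^n\times\mathbb{R}^N\times\mathbb{R}$ with $A_{00}+\mathcal{A}^*(x^s,u^s,t^s)\succ0$; 2. (Compactness) $\mathfrak{D}_{\bar x}$ is nonempty and compact; 3. (Strict complementarity) $0\in\operatorname{ri}\,\partial F(\bar x,u,f(\bar x))$ for all $u\in\mathfrak{D}_{\bar x}$, where $\operatorname{ri}$ denotes the relative interior. Then $f$ satisfies the KL property at $\bar x$ with exponent $\tfrac12$. -/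

import Mathlib

open scoped Topology

noncomputable section

namespace KLSDP

/-! ### Extended-real-valued functions and their limiting subdifferential -/

section Subdifferential

variable {E : Type*} [NormedAddCommGroup E] [InnerProductSpace ℝ E]

/-- `f` is proper: its domain is nonempty and it never takes the value `-∞`. -/
def IsProper (f : E → EReal) : Prop :=
  (∃ x, f x < ⊤) ∧ ∀ x, f x ≠ ⊥

/-- `f` is proper and closed, that is, proper and lower semicontinuous. -/
def IsProperClosed (f : E → EReal) : Prop :=
  IsProper f ∧ LowerSemicontinuous f

/-- The epigraph of `f`. -/
def epigraph (f : E → EReal) : Set (E × ℝ) :=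
  {p | f p.1 ≤ (p.2 : EReal)}

/-- The indicator function `δ_D`: zero on `D` and `+∞` off `D`. -/
def indicatorFn (D : Set E) (z : E) : EReal :=
  open Classical in if z ∈ D then 0 else ⊤

/-- The regular subdifferential of `f` at `x` (empty if `x ∉ dom f`). -/
def regularSubdifferential (f : E → EReal) (x : E) : Set E :=
  {ζ | f x < ⊤ ∧
    0 ≤ Filter.liminf
      (fun z : E => (f z - f x - ((inner ℝ ζ (z - x) : ℝ) : EReal)) / ((‖z - x‖ : ℝ) : EReal))
      (𝓝[≠] x)}

/-- The (limiting) subdifferential of `f` at `x` (empty if `x ∉ dom f`). -/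
def subdifferential (f : E → EReal) (x : E) : Set E :=
  {ζ | f x < ⊤ ∧ ∃ (xs : ℕ → E) (ζs : ℕ → E),
    Filter.Tendsto xs Filter.atTop (𝓝 x) ∧
    Filter.Tendsto (fun k => f (xs k)) Filter.atTop (𝓝 (f x)) ∧
    Filter.Tendsto ζs Filter.atTop (𝓝 ζ) ∧
    ∀ k, ζs k ∈ regularSubdifferential f (xs k)}

/-- The domain `dom ∂f` of the subdifferential. -/
def domSubdifferential (f : E → EReal) : Set E :=
  {x | (subdifferential f x).Nonempty}

/-! ### The Kurdyka-Łojasiewicz property -/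

/-- `h` satisfies the Kurdyka-Łojasiewicz inequality at `xhat` with desingularizing function `φ`:
there are `a ∈ (0, ∞]` and a neighborhood `V` of `xhat` such that `φ : [0, a) → [0, ∞)` is
continuous and concave with `φ 0 = 0`, is continuously differentiable on `(0, a)` with positive
derivative, and `φ'(h x - h xhat) * dist (0, ∂h x) ≥ 1` for all `x ∈ V` with
`h xhat < h x < h xhat + a`. The distance to the empty set is `+∞`. -/
def IsDesingularizingAt (h : E → EReal) (xhat : E) (φ : ℝ → ℝ) : Prop :=
  ∃ a : EReal, 0 < a ∧ ∃ V ∈ 𝓝 xhat,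
    ContinuousOn φ {s : ℝ | 0 ≤ s ∧ (s : EReal) < a} ∧
    ConcaveOn ℝ {s : ℝ | 0 ≤ s ∧ (s : EReal) < a} φ ∧
    (∀ s : ℝ, 0 ≤ s → (s : EReal) < a → 0 ≤ φ s) ∧
    φ 0 = 0 ∧
    ContDiffOn ℝ 1 φ {s : ℝ | 0 < s ∧ (s : EReal) < a} ∧
    (∀ s : ℝ, 0 < s → (s : EReal) < a → 0 < deriv φ s) ∧
    ∀ x ∈ V, h xhat < h x → h x < h xhat + a →
      1 ≤ ENNReal.ofReal (deriv φ (h x - h xhat).toReal) *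
        Metric.infEDist 0 (subdifferential h x)

/-- `h` satisfies the Kurdyka-Łojasiewicz property at `xhat` (a point of `dom ∂h`) with exponent
`α ∈ [0, 1)`: the desingularizing function can be chosen as `s ↦ c * s ^ (1 - α)`, `c > 0`. -/
def HasKLExponentAt (h : E → EReal) (xhat : E) (α : ℝ) : Prop :=
  xhat ∈ domSubdifferential h ∧ 0 ≤ α ∧ α < 1 ∧
    ∃ c : ℝ, 0 < c ∧ IsDesingularizingAt h xhat (fun s => c * s ^ (1 - α))

end Subdifferential

/-! ### Semidefinite representations -/

/-- The lifted space `ℝⁿ × ℝᴺ × ℝ` with its Euclidean inner product. -/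
abbrev LiftedSpace (n N : ℕ) : Type :=
  WithLp 2 (EuclideanSpace ℝ (Fin n) × WithLp 2 (EuclideanSpace ℝ (Fin N) × ℝ))

/-- The point `(x, u, t)` of the lifted space. -/
def liftedPoint {n N : ℕ} (x : EuclideanSpace ℝ (Fin n)) (u : EuclideanSpace ℝ (Fin N)) (t : ℝ) :
    LiftedSpace n N :=
  WithLp.toLp 2 (x, WithLp.toLp 2 (u, t))

/-- Symmetric `d × d` matrices `A₀₀, A₀, A₁, …, Aₙ, B₁, …, B_N`. -/
structure SDPData (n N d : ℕ) where
  A00 : Matrix (Fin d) (Fin d) ℝ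
  A0 : Matrix (Fin d) (Fin d) ℝ
  A : Fin n → Matrix (Fin d) (Fin d) ℝ
  B : Fin N → Matrix (Fin d) (Fin d) ℝ
  symm_A00 : A00.IsSymm
  symm_A0 : A0.IsSymm
  symm_A : ∀ i, (A i).IsSymm
  symm_B : ∀ j, (B j).IsSymm

namespace SDPData

variable {n N d : ℕ} (S : SDPData n N d)

/-- The linear map `𝒜* (x, u, t) = t A₀ + ∑ xᵢ Aᵢ + ∑ uⱼ Bⱼ`. -/
def adjointMap (z : LiftedSpace n N) : Matrix (Fin d) (Fin d) ℝ :=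
  z.snd.snd • S.A0 + ∑ i, z.fst i • S.A i + ∑ j, z.snd.fst j • S.B j

/-- The lifted feasible set `𝔇 = {(x, u, t) : A₀₀ + 𝒜* (x, u, t) ⪰ 0}`. -/
def feasibleSet : Set (LiftedSpace n N) :=
  {z | (S.A00 + S.adjointMap z).PosSemidef}

/-- `S` is a semidefinite representation of `f`: the epigraph of `f` is the projection of the
lifted feasible set onto the `(x, t)` variables. -/
def Represents (f : EuclideanSpace ℝ (Fin n) → EReal) : Prop :=
  epigraph f = {p | ∃ u : EuclideanSpace ℝ (Fin N), liftedPoint p.1 u p.2 ∈ S.feasibleSet}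

/-- The lifted function `F (x, u, t) = t + δ_𝔇 (x, u, t)`. -/
def liftedFn (z : LiftedSpace n N) : EReal :=
  (z.snd.snd : EReal) + indicatorFn S.feasibleSet z

/-- Slater's condition: `A₀₀ + 𝒜* (x, u, t) ≻ 0` for some `(x, u, t)`. -/
def Slater : Prop :=
  ∃ z : LiftedSpace n N, (S.A00 + S.adjointMap z).PosDef

/-- The slice `𝔇_x = {u : (x, u, f x) ∈ 𝔇}`, for a point `x` at which `f x` is finite. -/
def slice (f : EuclideanSpace ℝ (Fin n) → EReal) (x : EuclideanSpace ℝ (Fin n)) :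
    Set (EuclideanSpace ℝ (Fin N)) :=
  {u | liftedPoint x u (f x).toReal ∈ S.feasibleSet}

end SDPData

end KLSDP

end

namespace KLSDP

/-! ### Subgradients of convex functions; from quadratic growth to the KL inequality. -/

section Convex

variable {E : Type*} [NormedAddCommGroup E] [InnerProductSpace ℝ E]

/-! Projections of spectrahedra are convex, so `f` is convex and its limiting subgradients are
global ones. If points `x` near `xbar` lie within `C * √(f x - m)` of the level set `{f ≤ m}`, `m =
f xbar`, the subgradient inequality forces every subgradient at `x` to have norm at least `√(f x -
m) / C`: the KL inequality with exponent 1/2 (`hasKLExponentAt_half_of_quadratic_growth`).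

This growth is proved in the lifted space. Diagonalise the slack matrix at `z₀ = (xbar, u, m)` and
let `g` be the trace of the block of zero eigenvalues. Strict complementarity bounds `g` on the
feasible set by a multiple of the height increase `τ`. By 2×2 minors, all rows through that block
are then `O(√τ)` on bounded sets. A linear projection kills these rows and `τ`, and a small step
back towards `z₀` restores positive semidefiniteness; both cost `O(√τ)`
(`exists_posSemidef_norm_sub_le`).

Compactness of the slice keeps lifts of points near `(xbar, m)` bounded
(`exists_norm_sub_le_of_isBounded_fiber`), so the bound applies and projects down to `f`. -/

/-- A regular subgradient of a convex function satisfies the global subgradient inequality. -/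
theorem le_of_mem_regularSubdifferential {f : E → EReal} (hconv : Convex ℝ (epigraph f))
    (hbot : ∀ x, f x ≠ ⊥) {x ζ : E} (h : ζ ∈ regularSubdifferential f x) {y : E} {s : ℝ}
    (hy : f y ≤ s) : (f x).toReal + inner ℝ ζ (y - x) ≤ s := by
  obtain ⟨hx, hlim⟩ := h
  obtain ⟨r, hr⟩ : ∃ r : ℝ, f x = r := ⟨_, (EReal.coe_toReal hx.ne (hbot x)).symm⟩
  rw [hr, EReal.toReal_coe]
  rcases eq_or_ne y x with rfl | hyx
  · rw [hr] at hy
    simpa using EReal.coe_le_coe_iff.1 hy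
  by_contra! hlt
  have hpos : 0 < ‖y - x‖ := norm_pos_iff.2 (sub_ne_zero.2 hyx)
  -- By convexity, all difference quotients along the segment from `x` to `y` are at most this
  -- negative slope, so the liminf is too.
  set κ : ℝ := (s - r - inner ℝ ζ (y - x)) / ‖y - x‖ with hκ
  have hκneg : κ < 0 := div_neg_of_neg_of_pos (by linarith) hpos
  have hle : Filter.liminf (fun z : E => (f z - f x - ((inner ℝ ζ (z - x) : ℝ) : EReal)) /
      ((‖z - x‖ : ℝ) : EReal)) (𝓝[≠] x) ≤ (κ : EReal) := by
    refine Filter.liminf_le_of_frequently_le ?_ (by isBoundedDefault)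
    have hpath : Filter.Tendsto (fun τ : ℝ => x + τ • (y - x)) (𝓝[>] 0) (𝓝[≠] x) := by
      apply tendsto_nhdsWithin_iff.2 ⟨?_, ?_⟩
      · have : Continuous fun τ : ℝ => x + τ • (y - x) := by fun_prop
        simpa using (this.tendsto 0).mono_left nhdsWithin_le_nhds
      · filter_upwards [self_mem_nhdsWithin] with τ hτ
        simpa [sub_ne_zero.2 hyx] using (ne_of_gt hτ : τ ≠ 0)
    apply hpath.frequently
    apply Filter.Eventually.frequently
    filter_upwards [Ioo_mem_nhdsGT (zero_lt_one (α := ℝ))] with τ hτ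
    have hmem := hconv (x := (x, r)) (by simp [epigraph, hr]) (y := (y, s)) hy
      (a := 1 - τ) (b := τ) (by linarith [hτ.2]) hτ.1.le (by ring)
    have hz : x + τ • (y - x) = (1 - τ) • x + τ • y := by module
    have hfz : f (x + τ • (y - x)) ≤ (((1 - τ) * r + τ * s : ℝ) : EReal) := by
      rw [hz]; exact hmem
    have hnn : (0 : EReal) ≤ ((‖x + τ • (y - x) - x‖ : ℝ) : EReal) :=
      EReal.coe_nonneg.2 (norm_nonneg _)
    refine (EReal.div_le_div_right_of_nonneg hnn (EReal.sub_le_sub (EReal.sub_le_sub hfz le_rfl)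
      le_rfl)).trans ?_
    rw [hr, ← EReal.coe_sub, ← EReal.coe_sub, ← EReal.coe_div, EReal.coe_le_coe_iff]
    rw [add_sub_cancel_left, inner_smul_right, norm_smul, Real.norm_of_nonneg hτ.1.le, hκ]
    apply le_of_eq
    have := hτ.1.ne'
    field_simp
    ring
  exact absurd (hlim.trans hle) (not_le.2 (by exact_mod_cast hκneg))

/-- A limiting subgradient of a convex function satisfies the global subgradient inequality. -/
theorem le_of_mem_subdifferential {f : E → EReal} (hconv : Convex ℝ (epigraph f))
    (hbot : ∀ x, f x ≠ ⊥) {x ζ : E} (h : ζ ∈ subdifferential f x) {y : E} {s : ℝ}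
    (hy : f y ≤ s) : (f x).toReal + inner ℝ ζ (y - x) ≤ s := by
  obtain ⟨hx, xs, ζs, hxs, hfxs, hζs, hreg⟩ := h
  have hf := (EReal.tendsto_toReal hx.ne (hbot x)).comp hfxs
  exact le_of_tendsto' (hf.add (hζs.inner (tendsto_const_nhds.sub hxs)))
    fun k => le_of_mem_regularSubdifferential hconv hbot (hreg k) hy

/-- A global subgradient is a limiting subgradient. -/
theorem mem_subdifferential_of_forall_le {f : E → EReal} (hbot : ∀ x, f x ≠ ⊥) {x ζ : E}
    (hx : f x < ⊤) (h : ∀ y (s : ℝ), f y ≤ s → (f x).toReal + inner ℝ ζ (y - x) ≤ s) :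
    ζ ∈ subdifferential f x := by
  refine ⟨hx, fun _ => x, fun _ => ζ, tendsto_const_nhds, tendsto_const_nhds, tendsto_const_nhds,
    fun _ => ⟨hx, ?_⟩⟩
  apply Filter.le_liminf_of_le
  · exact Filter.isCobounded_ge_of_top
  refine Filter.Eventually.of_forall fun y => ?_
  apply EReal.div_nonneg _ (EReal.coe_nonneg.2 (norm_nonneg _))
  obtain ⟨r, hr⟩ : ∃ r : ℝ, f x = r := ⟨_, (EReal.coe_toReal hx.ne (hbot x)).symm⟩
  rcases eq_or_ne (f y) ⊤ with hy | hy
  · rw [hy, hr, EReal.top_sub_coe, EReal.top_sub_coe]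
    exact le_top
  · have := h y (f y).toReal (EReal.coe_toReal hy (hbot y)).ge
    rw [← EReal.coe_toReal hy (hbot y), hr, ← EReal.coe_sub, ← EReal.coe_sub, EReal.coe_nonneg]
    rw [hr, EReal.toReal_coe] at this
    linarith

/-- From a relative interior point one can move a little away from any point of the set. -/
theorem exists_neg_smul_mem_of_zero_mem_intrinsicInterior {s : Set E}
    (h0 : (0 : E) ∈ intrinsicInterior ℝ s) {ζ : E} (hζ : ζ ∈ s) :
    ∃ η : ℝ, 0 < η ∧ -η • ζ ∈ s := by
  obtain ⟨y, hy, hy0⟩ := mem_intrinsicInterior.1 h0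
  -- The line through 0 and `ζ` lies in the affine span, so relative interiority of 0 applies along
  -- it.
  have hmem (θ : ℝ) : -θ • ζ ∈ affineSpan ℝ s := by
    have := AffineMap.lineMap_mem (-θ) (hy0 ▸ y.2 : (0 : E) ∈ affineSpan ℝ s)
      (subset_affineSpan ℝ s hζ)
    simpa [AffineMap.lineMap_apply] using this
  have hcont : Continuous fun θ : ℝ => (⟨-θ • ζ, hmem θ⟩ : affineSpan ℝ s) := by fun_prop
  have hnhds : ∀ᶠ θ in 𝓝 (0 : ℝ), -θ • ζ ∈ s := by
    have h00 : (⟨-(0 : ℝ) • ζ, hmem 0⟩ : affineSpan ℝ s) = y := Subtype.ext (by simp [hy0])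
    have hs : Subtype.val ⁻¹' s ∈ 𝓝 (⟨-(0 : ℝ) • ζ, hmem 0⟩ : affineSpan ℝ s) := by
      rw [h00]
      exact mem_interior_iff_mem_nhds.1 hy
    exact hcont.continuousAt hs
  obtain ⟨η, hη, hηpos⟩ := ((hnhds.filter_mono nhdsWithin_le_nhds).and
    (self_mem_nhdsWithin : Set.Ioi (0 : ℝ) ∈ 𝓝[>] 0)).exists
  exact ⟨η, hηpos, hη⟩

/-- Quadratic growth of a convex function implies the KL property with exponent `1 / 2`. -/
theorem hasKLExponentAt_half_of_quadratic_growth {f : E → EReal}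
    (hconv : Convex ℝ (epigraph f)) (hbot : ∀ x, f x ≠ ⊥) {xbar : E}
    (hxbar : xbar ∈ domSubdifferential f) {m : ℝ} (hm : f xbar = m) {δ C : ℝ} (hδ : 0 < δ)
    (hC : 0 < C)
    (hgrowth : ∀ x ∈ Metric.ball xbar δ, ∀ r : ℝ, f x = r → m < r → r < m + δ →
      ∃ y, f y ≤ m ∧ ‖x - y‖ ≤ C * √(r - m)) :
    HasKLExponentAt f xbar (1 / 2) := by
  -- The factor `2 * C` makes the derivative `C / √s`, the reciprocal of the lower bound on
  -- subgradient norms.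
  refine ⟨hxbar, by norm_num, by norm_num, 2 * C, by positivity, δ, by exact_mod_cast hδ,
    Metric.ball xbar δ, Metric.ball_mem_nhds _ hδ, ?_⟩
  have hset : {s : ℝ | 0 ≤ s ∧ (s : EReal) < δ} = Set.Ico 0 δ := by
    ext s; simp [EReal.coe_lt_coe_iff]
  have hset' : {s : ℝ | 0 < s ∧ (s : EReal) < δ} = Set.Ioo 0 δ := by
    ext s; simp [EReal.coe_lt_coe_iff]
  have hexp : (1 - 1 / 2 : ℝ) = 1 / 2 := by norm_num
  have hderiv (s : ℝ) (hs : 0 < s) :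
      deriv (fun s : ℝ => 2 * C * s ^ (1 - 1 / 2 : ℝ)) s = C / √s := by
    have hd := ((Real.hasDerivAt_sqrt hs.ne').const_mul (2 * C)).deriv
    simp only [hexp, ← Real.sqrt_eq_rpow]
    rw [hd]
    have := (Real.sqrt_pos.2 hs).ne'
    field_simp
  rw [hset, hset']
  refine ⟨?_, ?_, ?_, ?_, ?_, ?_, ?_⟩
  · rw [hexp]
    exact (continuous_const.mul (Real.continuous_rpow_const (by norm_num))).continuousOn
  · rw [hexp]
    have := (Real.concaveOn_rpow (p := 1 / 2) (by norm_num) (by norm_num)).smul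
      (by positivity : (0 : ℝ) ≤ 2 * C)
    exact this.subset Set.Ico_subset_Ici_self (convex_Ico 0 δ)
  · intro s hs _
    positivity
  · norm_num
  · apply ContDiffOn.mul contDiffOn_const
    exact fun s hs => (Real.contDiffAt_rpow_const_of_ne hs.1.ne').contDiffWithinAt
  · intro s hs _
    rw [hderiv s hs]
    positivity
  · intro x hx hlt hlt'
    have hxtop : f x ≠ ⊤ := (hlt'.trans_le le_top).ne
    obtain ⟨r, hr⟩ : ∃ r : ℝ, f x = r := ⟨_, (EReal.coe_toReal hxtop (hbot x)).symm⟩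
    rw [hm, hr, ← EReal.coe_add, EReal.coe_lt_coe_iff] at hlt'
    rw [hm, hr, EReal.coe_lt_coe_iff] at hlt
    obtain ⟨y, hy, hxy⟩ := hgrowth x hx r hr hlt hlt'
    have hs : 0 < √(r - m) := Real.sqrt_pos.2 (by linarith)
    have hdist : ENNReal.ofReal (√(r - m) / C) ≤ Metric.infEDist 0 (subdifferential f x) := by
      -- Testing `ζ` at `y` gives `r - m ≤ ‖ζ‖ * C * √(r - m)`; then divide by the root.
      refine Metric.le_infEDist.2 fun ζ hζ => ?_
      have h1 := le_of_mem_subdifferential hconv hbot hζ hy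
      rw [hr, EReal.toReal_coe] at h1
      have h2 : -(‖ζ‖ * ‖x - y‖) ≤ inner ℝ ζ (y - x) := by
        rw [norm_sub_rev x y]
        exact neg_le_of_abs_le (abs_real_inner_le_norm _ _)
      have h3 : ‖ζ‖ * ‖x - y‖ ≤ ‖ζ‖ * (C * √(r - m)) := by gcongr
      have h4 : √(r - m) * √(r - m) = r - m := Real.mul_self_sqrt (by linarith)
      have h5 : √(r - m) ≤ ‖ζ‖ * C := by
        by_contra! h
        nlinarith
      rw [edist_dist, dist_zero_left]
      exact ENNReal.ofReal_le_ofReal ((div_le_iff₀ hC).2 h5)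
    rw [hm, hr, ← EReal.coe_sub, EReal.toReal_coe, hderiv _ (by linarith)]
    calc (1 : ENNReal) = ENNReal.ofReal (C / √(r - m)) * ENNReal.ofReal (√(r - m) / C) := by
          rw [← ENNReal.ofReal_mul (by positivity)]
          simp [div_mul_div_cancel₀ hs.ne', hC.ne']
      _ ≤ _ := by gcongr

end Convex

/-! ### Square-root error bound for linear sections of the semidefinite cone. -/

section ErrorBound

open Matrix

/-- A 2×2 principal minor is nonnegative. This is where the square root arises: a diagonal entry of
order `τ` forces its whole row to be of order `√τ`. -/
theorem sq_entry_le_of_posSemidef {ι : Type*} {M : Matrix ι ι ℝ} (hM : M.PosSemidef)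
    (i j : ι) : M i j ^ 2 ≤ M i i * M j j := by
  have h := (hM.submatrix ![i, j]).det_nonneg
  have hs : M j i = M i j := by simpa using hM.1.apply i j
  rw [det_fin_two] at h
  simp only [submatrix_apply, cons_val_zero, cons_val_one, hs] at h
  nlinarith

variable {ι : Type*} [Fintype ι]

theorem neg_le_dotProduct_mulVec_of_abs_entry_le {M : Matrix ι ι ℝ} {b : ℝ}
    (hM : ∀ i j, |M i j| ≤ b) (v : ι → ℝ) :
    -(b * Fintype.card ι * ∑ i, v i ^ 2) ≤ v ⬝ᵥ M *ᵥ v := by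
  have hterm (i j : ι) : -(b * ((v i ^ 2 + v j ^ 2) / 2)) ≤ v i * (M i j * v j) := by
    have h1 : |v i * (M i j * v j)| ≤ b * ((v i ^ 2 + v j ^ 2) / 2) := by
      calc |v i * (M i j * v j)| = |M i j| * (|v i| * |v j|) := by
            rw [abs_mul, abs_mul]; ring
        _ ≤ b * ((v i ^ 2 + v j ^ 2) / 2) := by
            have hb := (abs_nonneg _).trans (hM i j)
            have : |v i| * |v j| ≤ (v i ^ 2 + v j ^ 2) / 2 := by
              nlinarith [sq_nonneg (|v i| - |v j|), sq_abs (v i), sq_abs (v j)]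
            exact mul_le_mul (hM i j) this (by positivity) hb
    exact (abs_le.1 h1).1
  have hsum : ∑ i, ∑ j, (b * ((v i ^ 2 + v j ^ 2) / 2)) = b * Fintype.card ι * ∑ i, v i ^ 2 := by
    simp only [← Finset.mul_sum, ← Finset.sum_div, Finset.sum_add_distrib, Finset.sum_const,
      Finset.card_univ, nsmul_eq_mul]
    ring
  rw [← hsum, ← Finset.sum_neg_distrib]
  simp only [dotProduct, mulVec, Finset.mul_sum, ← Finset.sum_neg_distrib]
  exact Finset.sum_le_sum fun i _ => Finset.sum_le_sum fun j _ => hterm i j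

/-- A matrix supported on a face, close to a positive semidefinite matrix, becomes positive
semidefinite when mixed with a matrix in the relative interior of the face. -/
theorem posSemidef_mix_diagonal [DecidableEq ι] {M M' : Matrix ι ι ℝ} {l : ι → ℝ} {μ b s : ℝ}
    (hM : M.PosSemidef) (hM' : M'.IsHermitian) (hl : ∀ i, l i ≠ 0 → μ ≤ l i)
    (hzero : ∀ i j, l i = 0 → M' i j = 0) (hclose : ∀ i j, |(M' - M) i j| ≤ b)
    (hs0 : 0 ≤ s) (hs1 : s ≤ 1) (hs : (1 - s) * (b * Fintype.card ι) ≤ s * μ) :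
    ((1 - s) • M' + s • diagonal l).PosSemidef := by
  have hherm : ((1 - s) • M' + s • diagonal l).IsHermitian := by
    refine IsHermitian.add ?_ ?_
    · rw [IsHermitian, conjTranspose_smul, hM'.eq, star_trivial]
    · rw [IsHermitian, conjTranspose_smul, (isHermitian_diagonal l).eq, star_trivial]
  refine .of_dotProduct_mulVec_nonneg hherm fun v => ?_
  rw [star_trivial]
  -- Only the coordinates in the support of `l` matter to `M'`. On them the negative part of `M'` is
  -- at most `b * card ι`, which `s * μ` outweighs.
  set u : ι → ℝ := fun i => if l i = 0 then 0 else v i with hu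
  have hzero' (i j : ι) (hj : l j = 0) : M' i j = 0 := by
    have := hM'.apply i j
    rw [star_trivial] at this
    rw [← this, hzero j i hj]
  have h1 : v ⬝ᵥ M' *ᵥ v = u ⬝ᵥ M' *ᵥ u := by
    simp only [dotProduct, mulVec, Finset.mul_sum]
    refine Finset.sum_congr rfl fun i _ => Finset.sum_congr rfl fun j _ => ?_
    by_cases hi : l i = 0
    · simp [hzero i j hi]
    by_cases hj : l j = 0
    · simp [hzero' i j hj]
    simp [hu, hi, hj]
  have h2 : μ * ∑ i, u i ^ 2 ≤ v ⬝ᵥ diagonal l *ᵥ v := by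
    simp only [dotProduct, mulVec_diagonal, Finset.mul_sum]
    refine Finset.sum_le_sum fun i _ => ?_
    by_cases hi : l i = 0
    · simp [hu, hi]
    · simp only [hu, hi, if_false]
      nlinarith [hl i hi, sq_nonneg (v i)]
  have h3 : u ⬝ᵥ M' *ᵥ u = u ⬝ᵥ M *ᵥ u + u ⬝ᵥ (M' - M) *ᵥ u := by
    rw [sub_mulVec, dotProduct_sub]; ring
  have h4 := hM.dotProduct_mulVec_nonneg u
  rw [star_trivial] at h4
  have h5 := neg_le_dotProduct_mulVec_of_abs_entry_le hclose u
  have h6 : 0 ≤ ∑ i, u i ^ 2 := Finset.sum_nonneg fun i _ => sq_nonneg _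
  rw [add_mulVec, dotProduct_add, smul_mulVec, smul_mulVec, dotProduct_smul, dotProduct_smul,
    smul_eq_mul, smul_eq_mul, h1, h3]
  have h7 : (1 - s) * -(b * Fintype.card ι * ∑ i, u i ^ 2) ≤
      (1 - s) * (u ⬝ᵥ M *ᵥ u + u ⬝ᵥ (M' - M) *ᵥ u) :=
    mul_le_mul_of_nonneg_left (by linarith) (by linarith)
  have h8 := mul_le_mul_of_nonneg_left h2 hs0
  have h9 := mul_le_mul_of_nonneg_right hs h6
  nlinarith

variable {E F : Type*} [NormedAddCommGroup E] [NormedSpace ℝ E] [FiniteDimensional ℝ E]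
  [NormedAddCommGroup F] [NormedSpace ℝ F]

theorem exists_norm_apply_le (T : E →ₗ[ℝ] F) : ∃ B : ℝ, 0 < B ∧ ∀ h, ‖T h‖ ≤ B * ‖h‖ :=
  let ⟨B, hB, h⟩ := (LinearMap.toContinuousLinearMap T).bound
  ⟨B, hB, h⟩

/-- The distance to the kernel of a linear map is controlled by the norm of the image. -/
theorem exists_ker_norm_sub_le (T : E →ₗ[ℝ] F) :
    ∃ C : ℝ, 0 < C ∧ ∀ h, ∃ w, T w = 0 ∧ ‖h - w‖ ≤ C * ‖T h‖ := by
  -- A linear section `g` of `T` over its range is bounded in finite dimension; subtracting `g (T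
  -- h)` from `h` lands in the kernel.
  obtain ⟨g, hg⟩ := T.rangeRestrict.exists_rightInverse_of_surjective T.range_rangeRestrict
  obtain ⟨C, hC, hgC⟩ := exists_norm_apply_le g
  refine ⟨C, hC, fun h => ⟨h - g (T.rangeRestrict h), ?_, ?_⟩⟩
  · have := congrArg Subtype.val (LinearMap.congr_fun hg (T.rangeRestrict h))
    have hT : T (g (T.rangeRestrict h)) = T h := this
    rw [map_sub, hT, sub_self]
  · simpa using hgC (T.rangeRestrict h)

theorem exists_abs_entry_le (L : E →ₗ[ℝ] Matrix ι ι ℝ) :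
    ∃ B : ℝ, 0 < B ∧ ∀ h i j, |L h i j| ≤ B * ‖h‖ := by
  obtain ⟨B, hB, h⟩ := exists_norm_apply_le
    (LinearMap.pi fun p : ι × ι => entryLinearMap ℝ ℝ p.1 p.2 ∘ₗ L)
  exact ⟨B, hB, fun z i j => (norm_le_pi_norm _ (i, j)).trans (h z)⟩

/-- Hölderian error bound of order `1 / 2` for a linear section of the positive semidefinite cone,
under a certificate of strict complementarity. -/
theorem exists_posSemidef_norm_sub_le [DecidableEq ι] {l : ι → ℝ} (hl : ∀ i, 0 ≤ l i)
    (L : E →ₗ[ℝ] Matrix ι ι ℝ) (hL : ∀ h, (L h).IsHermitian) (τ : E →ₗ[ℝ] ℝ) {C : ℝ} (hC : 0 ≤ C)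
    (hcert : ∀ h, (diagonal l + L h).PosSemidef → ∑ i with l i = 0, L h i i ≤ C * τ h) (R : ℝ) :
    ∃ K : ℝ, 0 < K ∧ ∀ h, (diagonal l + L h).PosSemidef → ‖h‖ ≤ R → 0 ≤ τ h → τ h ≤ 1 →
      ∃ h', (diagonal l + L h').PosSemidef ∧ τ h' = 0 ∧ ‖h - h'‖ ≤ K * √(τ h) := by
  obtain ⟨B, hB, hLB⟩ := exists_abs_entry_le L
  obtain ⟨μ, hμ, hlμ⟩ : ∃ μ : ℝ, 0 < μ ∧ ∀ i, l i ≠ 0 → μ ≤ l i := by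
    rcases (Finset.univ.filter fun i => l i ≠ 0).eq_empty_or_nonempty with he | hne
    · refine ⟨1, one_pos, fun i hi => ?_⟩
      have : i ∈ (Finset.univ.filter fun i => l i ≠ 0) := by simp [hi]
      simp [he] at this
    · obtain ⟨i, hi, hmin⟩ := Finset.exists_min_image _ l hne
      rw [Finset.mem_filter] at hi
      exact ⟨l i, lt_of_le_of_ne (hl i) hi.2.symm, fun j hj => hmin j (by simp [hj])⟩
  -- The kernel of `T` is cut out by the linear equations wanted of `h'`: zero rows wherever `l`
  -- vanishes, and `τ = 0`.
  let T : E →ₗ[ℝ] (ι × ι → ℝ) × ℝ := LinearMap.prod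
    (LinearMap.pi fun p => if l p.1 = 0 then entryLinearMap ℝ ℝ p.1 p.2 ∘ₗ L else 0) τ
  obtain ⟨C₁, hC₁, hT⟩ := exists_ker_norm_sub_le T
  -- `Λ` bounds every diagonal entry of `diagonal l + L h` when `‖h‖ ≤ R`.
  set Λ : ℝ := ∑ i, l i + B * |R| with hΛ
  have hΛ0 : 0 ≤ Λ := add_nonneg (Finset.sum_nonneg fun i _ => hl i) (by positivity)
  set C₂ : ℝ := C₁ * (√(C * Λ) + 1) with hC₂
  have hC₂0 : 0 < C₂ := by positivity
  set K₃ : ℝ := B * C₂ * Fintype.card ι / μ with hK₃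
  have hK₃0 : 0 ≤ K₃ := by positivity
  refine ⟨C₂ + K₃ * (|R| + C₂), by positivity, fun h hpsd hR h0 h1 => ?_⟩
  have hR' : ‖h‖ ≤ |R| := hR.trans (le_abs_self R)
  have hsq1 : √(τ h) ≤ 1 := Real.sqrt_le_one.2 h1
  have hentry (i j : ι) (hi : l i = 0) : |L h i j| ≤ √(C * Λ) * √(τ h) := by
    have hMij : (diagonal l + L h) i j = L h i j := by
      by_cases hij : i = j
      · subst hij; simp [hi]
      · simp [hij]
    have hMii : (diagonal l + L h) i i ≤ C * τ h := by
      refine le_trans ?_ (hcert h hpsd)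
      have : (diagonal l + L h) i i = L h i i := by simp [hi]
      rw [this]
      refine Finset.single_le_sum (f := fun i => L h i i) (fun k hk => ?_) (by simp [hi])
      have := hpsd.diag_nonneg (i := k)
      rw [Finset.mem_filter] at hk
      simpa [hk.2] using this
    have hMjj : (diagonal l + L h) j j ≤ Λ := by
      rw [Matrix.add_apply, diagonal_apply_eq]
      refine add_le_add (Finset.single_le_sum (fun k _ => hl k) (Finset.mem_univ j)) ?_
      exact ((le_abs_self _).trans (hLB h j j)).trans (by gcongr)
    have hsq := sq_entry_le_of_posSemidef hpsd i j
    rw [hMij] at hsq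
    rw [← Real.sqrt_mul (by positivity)]
    refine Real.abs_le_sqrt (hsq.trans ?_)
    calc _ ≤ (C * τ h) * Λ := mul_le_mul hMii hMjj hpsd.diag_nonneg (by positivity)
      _ = C * Λ * τ h := by ring
  have hTh : ‖T h‖ ≤ (√(C * Λ) + 1) * √(τ h) := by
    refine max_le ?_ ?_
    · refine (pi_norm_le_iff_of_nonneg (by positivity)).2 fun p => ?_
      by_cases hp : l p.1 = 0
      · have : (T h).1 p = L h p.1 p.2 := by simp [T, hp]
        rw [this, Real.norm_eq_abs]
        exact (hentry _ _ hp).trans (by gcongr; linarith)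
      · have : (T h).1 p = 0 := by simp [T, hp]
        rw [this, norm_zero]
        positivity
    · change ‖τ h‖ ≤ _
      rw [Real.norm_of_nonneg h0]
      have h2 : √(τ h) * √(τ h) = τ h := Real.mul_self_sqrt h0
      have h3 := Real.sqrt_nonneg (τ h)
      have h4 := mul_nonneg (Real.sqrt_nonneg (C * Λ)) h3
      nlinarith
  obtain ⟨w, hTw, hw⟩ := hT h
  have hw' : ‖h - w‖ ≤ C₂ * √(τ h) := by
    refine hw.trans ?_
    rw [hC₂, mul_assoc]
    gcongr
  have hτw : τ w = 0 := congrArg Prod.snd hTw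
  have hLw (i j : ι) (hi : l i = 0) : L w i j = 0 := by
    have := congrFun (congrArg Prod.fst hTw) (i, j)
    simpa [T, hi] using this
  -- `K₃` is chosen so that `K₃ * √(τ h) * μ` equals the possible negativity of `diagonal l + L w`.
  -- If the cap 1 is reached, the witness is simply 0.
  set s : ℝ := min 1 (K₃ * √(τ h)) with hs
  have hs0 : 0 ≤ s := le_min zero_le_one (by positivity)
  have hs1 : s ≤ 1 := min_le_left _ _
  refine ⟨(1 - s) • w, ?_, by simp [hτw], ?_⟩
  · have hmix := posSemidef_mix_diagonal (M' := diagonal l + L w) (s := s)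
      (b := B * (C₂ * √(τ h))) hpsd ((isHermitian_diagonal l).add (hL w)) hlμ ?_ ?_ hs0 hs1 ?_
    · convert hmix using 1
      rw [map_smul]
      module
    · intro i j hi
      by_cases hij : i = j
      · subst hij; simp [hi, hLw i i hi]
      · simp [hij, hLw i j hi]
    · intro i j
      rw [add_sub_add_left_eq_sub, ← map_sub]
      refine (hLB _ i j).trans ?_
      rw [norm_sub_rev]
      gcongr
    · rcases min_choice 1 (K₃ * √(τ h)) with hc | hc
      · rw [← hs] at hc
        rw [hc]
        simpa using hμ.le
      · rw [← hs] at hc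
        have : s * μ = B * (C₂ * √(τ h)) * Fintype.card ι := by
          rw [hc, hK₃]
          field_simp
        rw [this]
        exact mul_le_of_le_one_left (by positivity) (by linarith)
  · have hwn : ‖w‖ ≤ |R| + C₂ := by
      have : w = h - (h - w) := by abel
      rw [this]
      refine (norm_sub_le _ _).trans (add_le_add hR' (hw'.trans ?_))
      exact mul_le_of_le_one_right hC₂0.le hsq1
    have : h - (1 - s) • w = (h - w) + s • w := by module
    rw [this]
    refine (norm_add_le _ _).trans ?_
    rw [norm_smul, Real.norm_of_nonneg hs0]
    calc ‖h - w‖ + s * ‖w‖ ≤ C₂ * √(τ h) + K₃ * √(τ h) * (|R| + C₂) := by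
          gcongr
          exact min_le_right _ _
      _ = _ := by ring

end ErrorBound

/-! ### Boundedness of nearby fibers and closedness of the feasible set. -/

section Bounded

variable {E F : Type*} [NormedAddCommGroup E] [NormedSpace ℝ E] [FiniteDimensional ℝ E]
  [NormedAddCommGroup F] [NormedSpace ℝ F]

/-- If one fiber of a closed convex set under a linear map is bounded, then so are the nearby
fibers. -/
theorem exists_norm_sub_le_of_isBounded_fiber {D : Set E} (hconv : Convex ℝ D)
    (hclosed : IsClosed D) (T : E →ₗ[ℝ] F) {z₀ : E} (hz₀ : z₀ ∈ D)
    (hb : Bornology.IsBounded {z ∈ D | T z = T z₀}) :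
    ∃ δ : ℝ, 0 < δ ∧ ∃ R : ℝ, ∀ z ∈ D, ‖T (z - z₀)‖ < δ → ‖z - z₀‖ ≤ R := by
  have : ProperSpace E := FiniteDimensional.proper ℝ E
  obtain ⟨R₀, hR₀⟩ := hb.subset_closedBall z₀
  -- The sphere of radius `R` misses the fiber through `z₀`, so `‖T (z - z₀)‖` has a positive
  -- minimum on its compact intersection with `D`.
  set R : ℝ := |R₀| + 1 with hR
  have hRpos : 0 < R := by positivity
  have hcpt : IsCompact (D ∩ Metric.sphere z₀ R) := (isCompact_sphere z₀ R).inter_left hclosed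
  have hcont : Continuous fun z => ‖T (z - z₀)‖ :=
    (T.continuous_of_finiteDimensional.comp (continuous_id.sub continuous_const)).norm
  obtain ⟨δ, hδ, hmin⟩ : ∃ δ : ℝ, 0 < δ ∧ ∀ z ∈ D ∩ Metric.sphere z₀ R, δ ≤ ‖T (z - z₀)‖ := by
    rcases (D ∩ Metric.sphere z₀ R).eq_empty_or_nonempty with he | hne
    · exact ⟨1, one_pos, fun z hz => by simp [he] at hz⟩
    · obtain ⟨z, hz, hmin⟩ := hcpt.exists_isMinOn hne hcont.continuousOn
      refine ⟨_, norm_pos_iff.2 fun h0 => ?_, fun y hy => hmin hy⟩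
      have hzR := hR₀ ⟨hz.1, by rwa [map_sub, sub_eq_zero] at h0⟩
      have hzs := Metric.mem_sphere.1 hz.2
      rw [Metric.mem_closedBall] at hzR
      linarith [le_abs_self R₀]
  refine ⟨δ, hδ, R, fun z hz hTz => ?_⟩
  by_contra! hlt
  have hpos : 0 < ‖z - z₀‖ := hRpos.trans hlt
  have hθ0 : 0 < R / ‖z - z₀‖ := by positivity
  have hθ1 : R / ‖z - z₀‖ ≤ 1 := (div_le_one hpos).2 hlt.le
  -- A point of `D` farther out is pulled back to the sphere along the segment to `z₀`, which only
  -- shrinks its image under `T`.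
  have hmem : z₀ + (R / ‖z - z₀‖) • (z - z₀) ∈ D := hconv.add_smul_sub_mem hz₀ hz ⟨hθ0.le, hθ1⟩
  have hle := hmin _ ⟨hmem, by
    rw [mem_sphere_iff_norm, add_sub_cancel_left, norm_smul, Real.norm_of_nonneg hθ0.le,
      div_mul_cancel₀ _ hpos.ne']⟩
  rw [add_sub_cancel_left, map_smul, norm_smul, Real.norm_of_nonneg hθ0.le] at hle
  have := mul_le_of_le_one_left (norm_nonneg (T (z - z₀))) hθ1
  linarith

theorem isClosed_setOf_posSemidef_add {ι : Type*} [Fintype ι] {A : Matrix ι ι ℝ}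
    (hA : A.IsHermitian) (L : E →ₗ[ℝ] Matrix ι ι ℝ) (hL : ∀ z, (L z).IsHermitian) :
    IsClosed {z | (A + L z).PosSemidef} := by
  have h : {z | (A + L z).PosSemidef} = ⋂ v : ι → ℝ, {z | 0 ≤ star v ⬝ᵥ (A + L z).mulVec v} := by
    ext z
    simp only [Set.mem_ofPred_eq, Set.mem_iInter]
    exact ⟨fun hz v => hz.dotProduct_mulVec_nonneg v,
      fun hz => .of_dotProduct_mulVec_nonneg (hA.add (hL z)) hz⟩
  rw [h]
  refine isClosed_iInter fun v => isClosed_le continuous_const ?_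
  have hc : Continuous L := continuous_matrix fun i j =>
    (Matrix.entryLinearMap ℝ ℝ i j ∘ₗ L).continuous_of_finiteDimensional
  exact continuous_const.dotProduct ((continuous_const.add hc).matrix_mulVec continuous_const)

end Bounded

theorem exists_inner_eq {E : Type*} [NormedAddCommGroup E] [InnerProductSpace ℝ E]
    [FiniteDimensional ℝ E] (φ : E →ₗ[ℝ] ℝ) : ∃ ζ : E, ∀ h, inner ℝ ζ h = φ h :=
  ⟨(InnerProductSpace.toDual ℝ E).symm (LinearMap.toContinuousLinearMap φ), fun h => by
    rw [InnerProductSpace.toDual_symm_apply, LinearMap.coe_toContinuousLinearMap']⟩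

theorem exists_isUnit_star_mul_mul_eq_diagonal {ι : Type*} [Fintype ι] [DecidableEq ι]
    {G : Matrix ι ι ℝ} (hG : G.PosSemidef) :
    ∃ U : Matrix ι ι ℝ, IsUnit U ∧ ∃ l : ι → ℝ, (∀ i, 0 ≤ l i) ∧
      star U * G * U = Matrix.diagonal l := by
  refine ⟨hG.1.eigenvectorUnitary, Unitary.isUnit_coe, hG.1.eigenvalues, hG.eigenvalues_nonneg, ?_⟩
  have := hG.1.conjStarAlgAut_star_eigenvectorUnitary
  rw [Unitary.conjStarAlgAut_star_apply] at this
  exact this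

/-- The coordinate `(x, u, t) ↦ t`. -/
def heightLin (n N : ℕ) : LiftedSpace n N →ₗ[ℝ] ℝ where
  toFun z := z.snd.snd
  map_add' _ _ := rfl
  map_smul' _ _ := rfl

/-- The projection `(x, u, t) ↦ (x, t)`. -/
def baseLin (n N : ℕ) : LiftedSpace n N →ₗ[ℝ] EuclideanSpace ℝ (Fin n) × ℝ where
  toFun z := (z.fst, z.snd.snd)
  map_add' _ _ := rfl
  map_smul' _ _ := rfl

/-! ### The lifted problem: convexity, strict complementarity and error bound. -/

namespace SDPData

variable {n N d : ℕ} (S : SDPData n N d)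

/-- `adjointMap` as a linear map. -/
def adjointLin : LiftedSpace n N →ₗ[ℝ] Matrix (Fin d) (Fin d) ℝ where
  toFun := S.adjointMap
  map_add' z w := by
    simp only [adjointMap, WithLp.add_fst, WithLp.add_snd, PiLp.add_apply, add_smul,
      Finset.sum_add_distrib]
    abel
  map_smul' c z := by
    simp only [adjointMap, WithLp.smul_fst, WithLp.smul_snd, PiLp.smul_apply, smul_assoc,
      smul_add, Finset.smul_sum, RingHom.id_apply]

theorem adjointMap_add (z w : LiftedSpace n N) :
    S.adjointMap (z + w) = S.adjointMap z + S.adjointMap w :=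
  S.adjointLin.map_add z w

theorem isHermitian_adjointMap (z : LiftedSpace n N) : (S.adjointMap z).IsHermitian := by
  have hsum {k : ℕ} (c : Fin k → ℝ) (M : Fin k → Matrix (Fin d) (Fin d) ℝ)
      (hM : ∀ i, (M i).IsSymm) : (∑ i, c i • M i).transpose = ∑ i, c i • M i := by
    rw [Matrix.transpose_sum]
    exact Finset.sum_congr rfl fun i _ => by rw [Matrix.transpose_smul, (hM i).eq]
  rw [Matrix.IsHermitian, Matrix.conjTranspose_eq_transpose_of_trivial, adjointMap,
    Matrix.transpose_add, Matrix.transpose_add, Matrix.transpose_smul, S.symm_A0.eq,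
    hsum _ _ S.symm_A, hsum _ _ S.symm_B]

theorem isHermitian_A00 : S.A00.IsHermitian := by
  rw [Matrix.IsHermitian, Matrix.conjTranspose_eq_transpose_of_trivial, S.symm_A00.eq]

theorem convex_feasibleSet : Convex ℝ S.feasibleSet := by
  intro z hz w hw a b ha hb hab
  have h : S.A00 + S.adjointMap (a • z + b • w) =
      a • (S.A00 + S.adjointMap z) + b • (S.A00 + S.adjointMap w) := by
    have h1 : S.adjointMap (a • z + b • w) = a • S.adjointMap z + b • S.adjointMap w := by
      have := S.adjointLin.map_add (a • z) (b • w)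
      rwa [map_smul, map_smul] at this
    rw [h1, smul_add, smul_add]
    calc _ = (a + b) • S.A00 + (a • S.adjointMap z + b • S.adjointMap w) := by
          rw [hab, one_smul]
      _ = _ := by module
  change (S.A00 + S.adjointMap (a • z + b • w)).PosSemidef
  rw [h]
  exact (Matrix.PosSemidef.smul hz ha).add (Matrix.PosSemidef.smul hw hb)

theorem isClosed_feasibleSet : IsClosed S.feasibleSet :=
  isClosed_setOf_posSemidef_add S.isHermitian_A00 S.adjointLin S.isHermitian_adjointMap

theorem liftedFn_ne_bot (z : LiftedSpace n N) : S.liftedFn z ≠ ⊥ := by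
  by_cases hz : z ∈ S.feasibleSet <;> simp [liftedFn, indicatorFn, hz]

theorem liftedFn_of_mem {z : LiftedSpace n N} (hz : z ∈ S.feasibleSet) :
    S.liftedFn z = (z.snd.snd : EReal) := by
  simp [liftedFn, indicatorFn, hz]

theorem liftedFn_le_coe_iff {z : LiftedSpace n N} {s : ℝ} :
    S.liftedFn z ≤ s ↔ z ∈ S.feasibleSet ∧ z.snd.snd ≤ s := by
  by_cases hz : z ∈ S.feasibleSet <;> simp [liftedFn, indicatorFn, hz]

theorem convex_epigraph_liftedFn : Convex ℝ (epigraph S.liftedFn) := by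
  have h : epigraph S.liftedFn = {p | p.1 ∈ S.feasibleSet ∧ p.1.snd.snd ≤ p.2} := by
    ext p
    exact S.liftedFn_le_coe_iff
  rw [h]
  rintro ⟨z, s⟩ hz ⟨w, t⟩ hw a b ha hb hab
  refine ⟨S.convex_feasibleSet hz.1 hw.1 ha hb hab, ?_⟩
  exact add_le_add (mul_le_mul_of_nonneg_left hz.2 ha) (mul_le_mul_of_nonneg_left hw.2 hb)

theorem convex_epigraph_of_represents {f : EuclideanSpace ℝ (Fin n) → EReal}
    (hrep : S.Represents f) : Convex ℝ (epigraph f) := by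
  rw [hrep]
  rintro ⟨x, s⟩ ⟨u, hu⟩ ⟨y, t⟩ ⟨v, hv⟩ a b ha hb hab
  exact ⟨a • u + b • v, S.convex_feasibleSet hu hv ha hb hab⟩

/-- Strict complementarity yields a linear certificate that bounds nonnegative functionals on the
feasible set vanishing at `z₀` by the increase of the last coordinate. -/
theorem exists_le_height_of_zero_mem_intrinsicInterior {z₀ : LiftedSpace n N}
    (hz₀ : z₀ ∈ S.feasibleSet)
    (h0 : (0 : LiftedSpace n N) ∈ intrinsicInterior ℝ (subdifferential S.liftedFn z₀))
    (g : LiftedSpace n N →ₗ[ℝ] ℝ) (hg : ∀ z ∈ S.feasibleSet, 0 ≤ g (z - z₀)) :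
    ∃ C : ℝ, 0 ≤ C ∧ ∀ z ∈ S.feasibleSet, g (z - z₀) ≤ C * heightLin n N (z - z₀) := by
  -- Since `g ≥ 0` on feasible displacements, the height minus `g` is still a subgradient of the
  -- lifted function at `z₀`.
  obtain ⟨ζ, hζ⟩ := exists_inner_eq (heightLin n N - g)
  have hinner (h : LiftedSpace n N) : inner ℝ ζ h = heightLin n N h - g h := hζ h
  have hF₀ := S.liftedFn_of_mem hz₀
  have hmem : ζ ∈ subdifferential S.liftedFn z₀ := by
    refine mem_subdifferential_of_forall_le S.liftedFn_ne_bot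
      (by rw [hF₀]; exact EReal.coe_lt_top _) fun z s hzs => ?_
    obtain ⟨hz, hs⟩ := S.liftedFn_le_coe_iff.1 hzs
    have h1 : heightLin n N (z - z₀) = z.snd.snd - z₀.snd.snd := rfl
    rw [hinner, hF₀, EReal.toReal_coe, h1]
    linarith [hg z hz]
  obtain ⟨η, hη, hηmem⟩ := exists_neg_smul_mem_of_zero_mem_intrinsicInterior h0 hmem
  -- The subgradient `-η • ζ` gives `-η * (height - g) ≤ height`, that is, `η * g ≤ (1 + η) *
  -- height`.
  refine ⟨(1 + η) / η, by positivity, fun z hz => ?_⟩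
  have h1 := le_of_mem_subdifferential S.convex_epigraph_liftedFn S.liftedFn_ne_bot hηmem
    (S.liftedFn_of_mem hz).le
  have h2 : heightLin n N (z - z₀) = z.snd.snd - z₀.snd.snd := rfl
  rw [hF₀, EReal.toReal_coe, inner_smul_left, hinner] at h1
  simp only [conj_trivial] at h1
  rw [div_mul_eq_mul_div, le_div_iff₀ hη]
  rw [h2] at h1 ⊢
  linarith

/-- Error bound for the minimizers of the lifted function under strict complementarity. -/
theorem exists_mem_feasibleSet_norm_sub_le {z₀ : LiftedSpace n N} (hz₀ : z₀ ∈ S.feasibleSet)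
    (h0 : (0 : LiftedSpace n N) ∈ intrinsicInterior ℝ (subdifferential S.liftedFn z₀)) (R : ℝ) :
    ∃ K : ℝ, 0 < K ∧ ∀ z ∈ S.feasibleSet, ‖z - z₀‖ ≤ R → z₀.snd.snd ≤ z.snd.snd →
      z.snd.snd ≤ z₀.snd.snd + 1 → ∃ w ∈ S.feasibleSet, w.snd.snd = z₀.snd.snd ∧
        ‖z - w‖ ≤ K * √(z.snd.snd - z₀.snd.snd) := by
  obtain ⟨U, hU, l, hl, hdiag⟩ := exists_isUnit_star_mul_mul_eq_diagonal hz₀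
  let L : LiftedSpace n N →ₗ[ℝ] Matrix (Fin d) (Fin d) ℝ :=
    LinearMap.mulRight ℝ U ∘ₗ LinearMap.mulLeft ℝ (star U) ∘ₗ S.adjointLin
  have hL (h : LiftedSpace n N) : L h = star U * S.adjointMap h * U := rfl
  have hmem (h : LiftedSpace n N) :
      (Matrix.diagonal l + L h).PosSemidef ↔ z₀ + h ∈ S.feasibleSet := by
    rw [← hdiag, hL, ← add_mul, ← mul_add, Matrix.IsUnit.posSemidef_star_left_conjugate_iff hU, add_assoc,
      ← adjointMap_add]
    rfl
  -- In the eigenbasis of the slack at `z₀`, the diagonal entries summed here vanish at `z₀` and are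
  -- nonnegative at every feasible point.
  let g : LiftedSpace n N →ₗ[ℝ] ℝ :=
    ∑ i with l i = 0, Matrix.entryLinearMap ℝ ℝ i i ∘ₗ L
  have hg (h : LiftedSpace n N) : g h = ∑ i with l i = 0, L h i i := by
    simp [g]
  obtain ⟨C, hC, hcert⟩ := S.exists_le_height_of_zero_mem_intrinsicInterior hz₀ h0 g
    fun z hz => by
      rw [hg]
      refine Finset.sum_nonneg fun i hi => ?_
      have hpsd := (hmem (z - z₀)).2 (by rwa [add_sub_cancel])
      have := hpsd.diag_nonneg (i := i)
      rw [Finset.mem_filter] at hi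
      simpa [hi.2] using this
  obtain ⟨K, hK, hbound⟩ := exists_posSemidef_norm_sub_le hl L
    (fun h => by
      rw [hL, Matrix.star_eq_conjTranspose]
      exact Matrix.isHermitian_conjTranspose_mul_mul U (S.isHermitian_adjointMap h))
    (heightLin n N) hC
    (fun h hh => by
      have := hcert _ ((hmem h).1 hh)
      rwa [add_sub_cancel_left, hg] at this) R
  refine ⟨K, hK, fun z hz hzR hle hle' => ?_⟩
  have hτ : heightLin n N (z - z₀) = z.snd.snd - z₀.snd.snd := rfl
  obtain ⟨h', hpsd, hτ', hdist⟩ := hbound (z - z₀) ((hmem _).2 (by rwa [add_sub_cancel])) hzR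
    (by rw [hτ]; linarith) (by rw [hτ]; linarith)
  refine ⟨z₀ + h', (hmem h').1 hpsd, ?_, ?_⟩
  · change z₀.snd.snd + heightLin n N h' = _
    rw [hτ', add_zero]
  · rwa [hτ, sub_sub] at hdist

end SDPData

end KLSDP

/-! ### Quadratic growth of `f` near `xbar`. -/

theorem mainTheorem3 (n N d : ℕ) (hN : 1 ≤ N) (hd : 1 ≤ d)
    (f : EuclideanSpace ℝ (Fin n) → EReal) (hf : KLSDP.IsProperClosed f)
    (S : KLSDP.SDPData n N d) (hrep : S.Represents f)
    (xbar : EuclideanSpace ℝ (Fin n)) (hxbar : xbar ∈ KLSDP.domSubdifferential f)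
    (hSlater : S.Slater)
    (hne : (S.slice f xbar).Nonempty) (hcpt : IsCompact (S.slice f xbar))
    (hsc : ∀ u ∈ S.slice f xbar,
      (0 : KLSDP.LiftedSpace n N) ∈ intrinsicInterior ℝ
        (KLSDP.subdifferential S.liftedFn (KLSDP.liftedPoint xbar u (f xbar).toReal))) :
    KLSDP.HasKLExponentAt f xbar (1 / 2) := by
  have hbot := hf.1.2
  have htop : f xbar ≠ ⊤ := hxbar.some_mem.1.ne
  obtain ⟨m, hm⟩ : ∃ m : ℝ, f xbar = m := ⟨_, (EReal.coe_toReal htop (hbot xbar)).symm⟩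
  obtain ⟨u, hu⟩ := hne
  have h0 := hsc u hu
  have hz₀ : KLSDP.liftedPoint xbar u m ∈ S.feasibleSet := by
    simpa [KLSDP.SDPData.slice, hm] using hu
  rw [hm, EReal.toReal_coe] at h0
  have hfiber : Bornology.IsBounded {z ∈ S.feasibleSet | KLSDP.baseLin n N z =
      KLSDP.baseLin n N (KLSDP.liftedPoint xbar u m)} := by
    have hcont : Continuous fun v : EuclideanSpace ℝ (Fin N) =>
        (KLSDP.liftedPoint xbar v m : KLSDP.LiftedSpace n N) := by
      unfold KLSDP.liftedPoint
      fun_prop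
    refine (hcpt.image hcont).isBounded.subset ?_
    rintro z ⟨hz, hbase⟩
    have hx : z.fst = xbar := congrArg Prod.fst hbase
    have ht : z.snd.snd = m := congrArg Prod.snd hbase
    have hzeq : KLSDP.liftedPoint xbar z.snd.fst m = z := by
      rw [← hx, ← ht]
      rfl
    refine ⟨z.snd.fst, ?_, hzeq⟩
    rw [KLSDP.SDPData.slice, Set.mem_ofPred_eq, hm, EReal.toReal_coe, hzeq]
    exact hz
  obtain ⟨δ, hδ, R, hR⟩ := KLSDP.exists_norm_sub_le_of_isBounded_fiber S.convex_feasibleSet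
    S.isClosed_feasibleSet (KLSDP.baseLin n N) hz₀ hfiber
  obtain ⟨K, hK, hbound⟩ := S.exists_mem_feasibleSet_norm_sub_le hz₀ h0 R
  -- The radius `δ` keeps lifts of `(x, r)` bounded; the cap 1 keeps the height increase in the
  -- range of the error bound.
  refine KLSDP.hasKLExponentAt_half_of_quadratic_growth (S.convex_epigraph_of_represents hrep) hbot
    hxbar hm (δ := min δ 1) (by positivity) hK fun x hx r hr hlt hlt' => ?_
  obtain ⟨v, hv⟩ : (x, r) ∈ {p : EuclideanSpace ℝ (Fin n) × ℝ | ∃ u : EuclideanSpace ℝ (Fin N),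
      KLSDP.liftedPoint p.1 u p.2 ∈ S.feasibleSet} := hrep ▸ hr.le
  have hbase : ‖KLSDP.baseLin n N (KLSDP.liftedPoint x v r - KLSDP.liftedPoint xbar u m)‖ < δ := by
    change ‖(x - xbar, r - m)‖ < δ
    refine max_lt ?_ ?_
    · exact (mem_ball_iff_norm.1 hx).trans_le (min_le_left _ _)
    · change ‖r - m‖ < δ
      rw [Real.norm_of_nonneg (by linarith)]
      linarith [min_le_left δ 1]
  obtain ⟨w, hw, hwt, hdist⟩ := hbound _ hv (hR _ hv hbase) hlt.le
    (by change r ≤ m + 1; linarith [min_le_right δ 1])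
  -- Feasibility of `w` at height `m` puts `w.fst` in `{f ≤ m}`, and projecting to `x` does not
  -- increase distances.
  refine ⟨w.fst, ?_, (WithLp.norm_fst_le _ _).trans hdist⟩
  have hmem : (w.fst, m) ∈ KLSDP.epigraph f := by
    rw [hrep]
    refine ⟨w.snd.fst, ?_⟩
    have hweq : KLSDP.liftedPoint w.fst w.snd.fst m = w := by
      have hwt' : m = w.snd.snd := hwt.symm
      rw [hwt']
      rfl
    rwa [hweq]
  exact hmem
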